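/- Let $\Omega=(0,1)\times(0,1)$, $\sigma>0$ and $0<w<1/2$. Write $|x|_\infty=\max(|x_1|,|x_2|)$, $|x|$ for the Euclidean norm on $\mathbb{R}^2$, $\|\cdot\|$ for the norm of $L^2(\Omega)$, and $$G_\sigma(x)=\sigma^{-2}e^{-|x|^2/(2\sigma^2)},\qquad \alpha_w=\frac1{2\pi}\int_{|x|_\infty<w}G_\sigma(x)\,dx .$$ For $u\in L^2(\Omega)$, extended by zero outside $\Omega$, the restricted Gaussian blurring operator is $$(K^{\sigma,w}u)(x)=\frac{\alpha_w^{-1}}{2\pi}\int_{|x-y|_\infty<w}G_\sigma(x-y)\,u(y)\,dy,\qquad x\in\Omega .$$ For $n\ge1$ and $h=1/n$, partition $\Omega$ (up to a null set) into the $n^2$ squares $R_k$ of side $h$ of the uniform grid, with centers $z_k$, and let $U_h$ be the space of functions that are constant on each $R_k$. Put $$w_h=\left(\left\lceil \tfrac wh-\tfrac12\right\rceil+\tfrac12\right)h,\qquad N_k=\{l:\ \mathrm{Int}(R_l)\cap\{y\in\Omega:|y-z_k|_\infty<w\}\neq\emptyset\},\qquad \gamma_{kl}=\frac{h^2}{2\pi\alpha_{w_h}}G_\sigma(z_k-z_l),$$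 and define $K_h:U_h\to U_h$ by $$(K_hu)(z_k)=(1+\eta)\sum_{l\in N_k}\gamma_{kl}\,u(z_l),$$ where the number $\eta$ (depending on $\sigma,w,h$) is chosen so that $(1+\eta)\sum_{l\in N_k}\gamma_{kl}=1$ for all $k$ for which $\{y\in\mathbb{R}^2:|y-z_k|_\infty<w_h\}\subseteq\Omega$. Theorem. There are constants $C>0$ and $h_0>0$, depending only on $\sigma$ and $w$, such that for all $h=1/n\le h_0$ there is exactly one such $\eta$, and $$\|(K^{\sigma,w}-K_h)u\|\le C\,h\,\|u\|\quad\text{and}\quad \|K_hu\|_{L^\infty(\Omega)}\le C\,\|u\|\qquad\text{for all }u\in U_h .$$ Consequently, for every sequence of such grids with sizes $h_j\le h_0$, the operators $K=K^{\sigma,w}$ and $K_j=K_{h_j}$ satisfy parts [b] and [c] of the smoothed approximation condition (SAC) with the constant $C$, which is independent of $j$: for all $j\in\mathbb{N}$ and all $u\in U_{h_j}$, [b] $\|Ku-K_ju\|\le C\,h_j\,\|u\|$ and [c] $\|K_ju\|_{L^\infty(\Omega)}\le C\,\|u\|$. -/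

import Mathlib

open MeasureTheory
open scoped ENNReal

noncomputable section

namespace GaussianBlur

/-- The domain `Ω = (0,1) × (0,1)`. The plane is `ℝ × ℝ`, whose Mathlib norm is the maximum norm
`|x|_∞ = max |x₁| |x₂|`. -/
def unitSquare : Set (ℝ × ℝ) := Set.Ioo 0 1 ×ˢ Set.Ioo 0 1

/-- Lebesgue measure on `Ω`. -/
def areaΩ : Measure (ℝ × ℝ) := volume.restrict unitSquare

/-- `G_σ(x) = σ⁻² exp (-|x|² / (2 σ²))`, where `|x|` is the Euclidean norm. -/
def gauss (σ : ℝ) (x : ℝ × ℝ) : ℝ :=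
  (σ ^ 2)⁻¹ * Real.exp (-(x.1 ^ 2 + x.2 ^ 2) / (2 * σ ^ 2))

/-- `α_w = (2π)⁻¹ ∫_{|x|_∞ < w} G_σ(x) dx`. -/
def alpha (σ w : ℝ) : ℝ :=
  (2 * Real.pi)⁻¹ * ∫ x in {x : ℝ × ℝ | ‖x‖ < w}, gauss σ x

/-- The restricted Gaussian blurring operator `K^{σ,w}` for functions on `Ω`: `u` is extended by
zero outside `Ω`, and
`(K^{σ,w} u)(x) = α_w⁻¹ (2π)⁻¹ ∫_{|x - y|_∞ < w} G_σ(x - y) u(y) dy`.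
Its restriction to `Ω` is what the norms below see, as they are taken with respect to `areaΩ`. -/
def blur (σ w : ℝ) (u : ℝ × ℝ → ℝ) (x : ℝ × ℝ) : ℝ :=
  (alpha σ w)⁻¹ * (2 * Real.pi)⁻¹ *
    ∫ y in {y : ℝ × ℝ | ‖x - y‖ < w}, gauss σ (x - y) * unitSquare.indicator u y

/-- The grid size `h = 1/n` of the uniform `n × n` grid on `Ω`. -/
def gridSize (n : ℕ) : ℝ := 1 / (n : ℝ)

/-- The interior of the square `R_k` of the uniform `n × n` grid, of side `h = 1/n`. -/
def cell (n : ℕ) (k : Fin n × Fin n) : Set (ℝ × ℝ) :=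
  Set.Ioo ((k.1 : ℝ) * gridSize n) (((k.1 : ℝ) + 1) * gridSize n) ×ˢ
    Set.Ioo ((k.2 : ℝ) * gridSize n) (((k.2 : ℝ) + 1) * gridSize n)

/-- The node `z_k`, the center of `R_k`. -/
def node (n : ℕ) (k : Fin n × Fin n) : ℝ × ℝ :=
  (((k.1 : ℝ) + 1 / 2) * gridSize n, ((k.2 : ℝ) + 1 / 2) * gridSize n)

/-- The piecewise constant function with the value `c k` on the square `R_k`, for every `k`
(and, by convention, `0` on the grid lines, a null set, and outside `Ω`). -/
def stepFunction (n : ℕ) : (Fin n × Fin n → ℝ) →ₗ[ℝ] (ℝ × ℝ → ℝ) where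
  toFun c x := ∑ k, (cell n k).indicator (fun _ => c k) x
  map_add' c d := by
    funext x
    simp only [Pi.add_apply, ← Finset.sum_add_distrib]
    exact Finset.sum_congr rfl fun k _ => by by_cases h : x ∈ cell n k <;> simp [h]
  map_smul' a c := by
    funext x
    simp only [Pi.smul_apply, smul_eq_mul, RingHom.id_apply, Finset.mul_sum]
    exact Finset.sum_congr rfl fun k _ => by by_cases h : x ∈ cell n k <;> simp [h]

/-- The space `U_h` of piecewise constant functions on the uniform grid with `h = 1/n`. -/
def piecewiseConstant (n : ℕ) : Submodule ℝ (ℝ × ℝ → ℝ) := LinearMap.range (stepFunction n)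

open Classical in
/-- The index set `N_k`: all `l` for which the interior of `R_l` intersects
`{y ∈ Ω : |y - z_k|_∞ < w}`. -/
def neighbours (w : ℝ) (n : ℕ) (k : Fin n × Fin n) : Finset (Fin n × Fin n) :=
  Finset.univ.filter fun l => (cell n l ∩ {y | y ∈ unitSquare ∧ ‖y - node n k‖ < w}).Nonempty

/-- `w_h = (⌈w/h - 1/2⌉ + 1/2) h`. -/
def discreteWidth (w : ℝ) (n : ℕ) : ℝ :=
  ((⌈w / gridSize n - 1 / 2⌉ : ℝ) + 1 / 2) * gridSize n

/-- The midpoint cubature weights `γ_{kl} = h² (2 α_{w_h} π)⁻¹ G_σ(z_k - z_l)`. -/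
def weight (σ w : ℝ) (n : ℕ) (k l : Fin n × Fin n) : ℝ :=
  gridSize n ^ 2 * (2 * alpha σ (discreteWidth w n) * Real.pi)⁻¹ * gauss σ (node n k - node n l)

/-- The condition on the renormalization parameter `η`: `(1 + η) ∑_{l ∈ N_k} γ_{kl} = 1` for all
`k` such that the square `{y ∈ ℝ² : |y - z_k|_∞ < w_h}` is contained in `Ω`. -/
def IsRenormalization (σ w : ℝ) (n : ℕ) (η : ℝ) : Prop :=
  ∀ k : Fin n × Fin n, {y : ℝ × ℝ | ‖y - node n k‖ < discreteWidth w n} ⊆ unitSquare →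
    (1 + η) * ∑ l ∈ neighbours w n k, weight σ w n k l = 1

/-- The nodal values `k ↦ (1 + η) ∑_{l ∈ N_k} γ_{kl} u(z_l)` of the discrete blurring of `u`. -/
def nodalBlur (σ w : ℝ) (n : ℕ) (η : ℝ) : (ℝ × ℝ → ℝ) →ₗ[ℝ] (Fin n × Fin n → ℝ) where
  toFun u k := (1 + η) * ∑ l ∈ neighbours w n k, weight σ w n k l * u (node n l)
  map_add' u v := by
    funext k
    simp only [Pi.add_apply, mul_add, Finset.sum_add_distrib]
  map_smul' a u := by
    funext k
    simp only [Pi.smul_apply, smul_eq_mul, RingHom.id_apply, Finset.mul_sum]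
    exact Finset.sum_congr rfl fun l _ => by ring

/-- The discrete operator `K_h` on `U_h`: `K_h u` is the piecewise constant function with
`(K_h u)(z_k) = (1 + η) ∑_{l ∈ N_k} γ_{kl} u(z_l)`. -/
def discreteBlur (σ w : ℝ) (n : ℕ) (η : ℝ) : piecewiseConstant n →ₗ[ℝ] piecewiseConstant n :=
  (stepFunction n).rangeRestrict ∘ₗ nodalBlur σ w n η ∘ₗ (piecewiseConstant n).subtype

/-- Part [b] of the smoothed approximation condition with constant `C`: an operator `K` and
discretizations `K_j` on spaces `U_j` with mesh sizes `h_j` satisfy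
`‖K u - K_j u‖_{L²(Ω)} ≤ C h_j ‖u‖_{L²(Ω)}` for all `j` and all `u ∈ U_j`. -/
def SmoothedApproximation (K : (ℝ × ℝ → ℝ) → (ℝ × ℝ → ℝ)) (U : ℕ → Submodule ℝ (ℝ × ℝ → ℝ))
    (Kd : ∀ j, U j →ₗ[ℝ] U j) (h : ℕ → ℝ) (C : ℝ) : Prop :=
  ∀ (j : ℕ) (u : U j),
    eLpNorm (K (u : ℝ × ℝ → ℝ) - (Kd j u : ℝ × ℝ → ℝ)) 2 areaΩ ≤
      ENNReal.ofReal (C * h j) * eLpNorm (u : ℝ × ℝ → ℝ) 2 areaΩ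

/-- Part [c] of the smoothed approximation condition with constant `C`:
`‖K_j u‖_{L^∞(Ω)} ≤ C ‖u‖_{L²(Ω)}` for all `j` and all `u ∈ U_j`. -/
def L2LinftyStability (U : ℕ → Submodule ℝ (ℝ × ℝ → ℝ)) (Kd : ∀ j, U j →ₗ[ℝ] U j)
    (C : ℝ) : Prop :=
  ∀ (j : ℕ) (u : U j),
    eLpNorm (Kd j u : ℝ × ℝ → ℝ) ∞ areaΩ ≤
      ENNReal.ofReal C * eLpNorm (u : ℝ × ℝ → ℝ) 2 areaΩ

end GaussianBlur

end

/-! The condition on `η` removes `α_{w_h}`: with `J` the mass of a full discrete stencil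
(`discreteMass`), it says `(1 + η) γ_{kl} = h² G_σ(z_k - z_l) / J`. A sum over nodes times `h²` is
an integral of a step function, so on `U_h` the operator `K_h` is an integral operator with kernel
`k_h / J`, `k_h` being constant on products of cells. Likewise `K` has kernel `k / I`, where `k` is
the truncated Gaussian and `I` its mass (`blurMass`).

The difference of the kernels is `(1/I - 1/J) k + (1/J) (k - k_h)`. The cutoffs of `k` and `k_h`
agree unless `|x - y|_∞` is within `2h` of `w`; where both are on, the Lipschitz bound of `G_σ`
gives `O(h)`, and the exceptional annulus has area `O(h)` (`abs_blurKernel_sub_discreteKernel_le`,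
`volume_translated_shell_le`). The same comparison applied to `u = 1` at an interior node gives `|I
- J| = O(h)` (`abs_blurMass_sub_discreteMass_le`), and `I`, `J` are bounded below. All row and
column integrals are thus `O(h)`, and the Schur test gives [b].

Part [c] needs only that `k_h / J` is bounded and that the `L¹` norm is at most the `L²` norm on
`Ω`, which has area 1. -/

/-- **Schur test** in `L²` for a kernel whose row and column integrals are at most `a`. -/
theorem eLpNorm_two_le_of_kernel_bound {α : Type*} [MeasurableSpace α] (μ : Measure α) [SFinite μ]
    (κ : α → α → ℝ≥0∞) (hκ : Measurable (Function.uncurry κ)) (a : ℝ≥0∞)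
    (hrow : ∀ x, ∫⁻ y, κ x y ∂μ ≤ a) (hcol : ∀ y, ∫⁻ x, κ x y ∂μ ≤ a) {u v : α → ℝ}
    (hu : Measurable u) (h : ∀ᵐ x ∂μ, ‖v x‖ₑ ≤ ∫⁻ y, κ x y * ‖u y‖ₑ ∂μ) :
    eLpNorm v 2 μ ≤ a * eLpNorm u 2 μ := by
  have key : ∀ x, (∫⁻ y, κ x y * ‖u y‖ₑ ∂μ) ^ (2 : ℝ) ≤ a * ∫⁻ y, κ x y * ‖u y‖ₑ ^ (2 : ℝ) ∂μ := by
    intro x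
    have hκx : Measurable (κ x) := hκ.comp measurable_prodMk_left
    -- Cauchy–Schwarz with the kernel split as `κ^{1/2} · κ^{1/2}`: one half yields the row
    -- integral, the other stays with `u`.
    have hH := ENNReal.lintegral_mul_le_Lp_mul_Lq μ Real.HolderConjugate.two_two
      (f := fun y => κ x y ^ (1 / 2 : ℝ)) (g := fun y => κ x y ^ (1 / 2 : ℝ) * ‖u y‖ₑ)
      (by fun_prop) (by fun_prop)
    have e0 : ∀ t : ℝ≥0∞, t ^ (1 / 2 : ℝ) * t ^ (1 / 2 : ℝ) = t := fun t => by
      rw [← ENNReal.rpow_add_of_nonneg _ _ (by norm_num) (by norm_num)]; norm_num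
    have e1 : ∀ t : ℝ≥0∞, (t ^ (1 / 2 : ℝ)) ^ (2 : ℝ) = t := fun t => by
      rw [← ENNReal.rpow_mul]; norm_num
    simp only [Pi.mul_apply, ← mul_assoc, e0, e1,
      ENNReal.mul_rpow_of_nonneg _ _ (zero_le_two : (0 : ℝ) ≤ 2)] at hH
    calc _ ≤ _ := ENNReal.rpow_le_rpow hH zero_le_two
      _ = (∫⁻ y, κ x y ∂μ) * ∫⁻ y, κ x y * ‖u y‖ₑ ^ (2 : ℝ) ∂μ := by
          rw [ENNReal.mul_rpow_of_nonneg _ _ zero_le_two, e1, e1]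
      _ ≤ _ := by gcongr; exact hrow x
  have main : ∫⁻ x, ‖v x‖ₑ ^ (2 : ℝ) ∂μ ≤ a ^ (2 : ℝ) * ∫⁻ y, ‖u y‖ₑ ^ (2 : ℝ) ∂μ := by
    have hm : Measurable fun p : α × α => κ p.1 p.2 * ‖u p.2‖ₑ ^ (2 : ℝ) :=
      Measurable.mul hκ (by fun_prop)
    calc ∫⁻ x, ‖v x‖ₑ ^ (2 : ℝ) ∂μ
        ≤ ∫⁻ x, a * ∫⁻ y, κ x y * ‖u y‖ₑ ^ (2 : ℝ) ∂μ ∂μ := by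
          refine lintegral_mono_ae ?_
          filter_upwards [h] with x hx
          exact (ENNReal.rpow_le_rpow hx zero_le_two).trans (key x)
      _ = a * ∫⁻ y, ∫⁻ x, κ x y * ‖u y‖ₑ ^ (2 : ℝ) ∂μ ∂μ := by
          rw [lintegral_const_mul _ hm.lintegral_prod_right', lintegral_lintegral_swap hm.aemeasurable]
      _ ≤ a * ∫⁻ y, a * ‖u y‖ₑ ^ (2 : ℝ) ∂μ := by
          gcongr with y
          have hκy : Measurable fun x => κ x y := hκ.comp measurable_prodMk_right
          rw [lintegral_mul_const _ hκy]
          gcongr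
          exact hcol y
      _ = _ := by
          rw [lintegral_const_mul _ (by fun_prop), ← mul_assoc, ENNReal.rpow_two, sq]
  rw [eLpNorm_eq_lintegral_rpow_enorm_toReal two_ne_zero ENNReal.ofNat_ne_top,
    eLpNorm_eq_lintegral_rpow_enorm_toReal two_ne_zero ENNReal.ofNat_ne_top]
  simp only [ENNReal.toReal_ofNat]
  calc _ ≤ _ := ENNReal.rpow_le_rpow main (by norm_num)
    _ = _ := by
      rw [ENNReal.mul_rpow_of_nonneg _ _ (by norm_num), ← ENNReal.rpow_mul]; norm_num

noncomputable section

namespace GaussianBlur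

/-! ### Bounds for the Gaussian. -/

theorem gauss_nonneg (σ : ℝ) (x : ℝ × ℝ) : 0 ≤ gauss σ x := by unfold gauss; positivity

theorem gauss_pos {σ : ℝ} (hσ : 0 < σ) (x : ℝ × ℝ) : 0 < gauss σ x := by unfold gauss; positivity

theorem gauss_le (σ : ℝ) (x : ℝ × ℝ) : gauss σ x ≤ (σ ^ 2)⁻¹ := by
  unfold gauss
  refine mul_le_of_le_one_right (by positivity) (Real.exp_le_one_iff.2 ?_)
  exact div_nonpos_of_nonpos_of_nonneg (by nlinarith [sq_nonneg x.1, sq_nonneg x.2]) (by positivity)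

theorem continuous_gauss (σ : ℝ) : Continuous (gauss σ) := by unfold gauss; fun_prop

/-- A lower bound of `G_σ` on the unit ball of the maximum norm. -/
def gaussMin (σ : ℝ) : ℝ := (σ ^ 2)⁻¹ * Real.exp (-2 / (2 * σ ^ 2))

theorem gaussMin_pos {σ : ℝ} (hσ : 0 < σ) : 0 < gaussMin σ := by unfold gaussMin; positivity

theorem abs_fst_le (x : ℝ × ℝ) : |x.1| ≤ ‖x‖ := norm_fst_le x

theorem abs_snd_le (x : ℝ × ℝ) : |x.2| ≤ ‖x‖ := norm_snd_le x

theorem gaussMin_le (σ : ℝ) {x : ℝ × ℝ} (hx : ‖x‖ ≤ 1) : gaussMin σ ≤ gauss σ x := by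
  unfold gauss gaussMin
  have h1 := (sq_le_one_iff_abs_le_one x.1).2 ((abs_fst_le x).trans hx)
  have h2 := (sq_le_one_iff_abs_le_one x.2).2 ((abs_snd_le x).trans hx)
  gcongr
  linarith

theorem abs_exp_neg_sub_exp_neg_le {s t : ℝ} (hs : 0 ≤ s) (ht : 0 ≤ t) :
    |Real.exp (-s) - Real.exp (-t)| ≤ |s - t| := by
  wlog hst : s ≤ t generalizing s t
  · rw [abs_sub_comm, abs_sub_comm s]
    exact this ht hs (le_of_not_ge hst)
  have h1 : Real.exp (-t) ≤ Real.exp (-s) := Real.exp_le_exp.2 (by linarith)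
  rw [abs_of_nonneg (by linarith), abs_of_nonpos (by linarith)]
  have h2 : Real.exp (-t) = Real.exp (-s) * Real.exp (-(t - s)) := by
    rw [← Real.exp_add]; ring_nf
  have h3 : 1 - (t - s) ≤ Real.exp (-(t - s)) := by
    have := Real.add_one_le_exp (-(t - s)); linarith
  have h4 : Real.exp (-s) ≤ 1 := Real.exp_le_one_iff.2 (by linarith)
  have h5 := Real.exp_pos (-s)
  rw [h2]
  nlinarith

/-- A Lipschitz constant of `G_σ` on the unit ball of the maximum norm. -/
def gaussLip (σ : ℝ) : ℝ := (σ ^ 2)⁻¹ * (4 / (2 * σ ^ 2))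

theorem gaussLip_nonneg (σ : ℝ) : 0 ≤ gaussLip σ := by unfold gaussLip; positivity

/-- The exponent is Lipschitz because `|a² - b²| ≤ 2 |a - b|` on `[-1, 1]`; the two coordinates
together give the 4 in `gaussLip`. The unit ball suffices, as it contains all differences of points
of `Ω`. -/
theorem abs_gauss_sub_gauss_le (σ : ℝ) {x y : ℝ × ℝ} (hx : ‖x‖ ≤ 1) (hy : ‖y‖ ≤ 1) :
    |gauss σ x - gauss σ y| ≤ gaussLip σ * ‖x - y‖ := by
  have aux : ∀ a b d : ℝ, |a| ≤ 1 → |b| ≤ 1 → |a - b| ≤ d → |a ^ 2 - b ^ 2| ≤ 2 * d := by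
    intro a b d ha hb hd
    have h1 : |a + b| ≤ 2 := (abs_add_le a b).trans (by linarith)
    rw [show a ^ 2 - b ^ 2 = (a + b) * (a - b) by ring, abs_mul]
    exact mul_le_mul h1 hd (abs_nonneg _) zero_le_two
  have h1 := aux x.1 y.1 ‖x - y‖ ((abs_fst_le x).trans hx) ((abs_fst_le y).trans hy)
    (abs_fst_le (x - y))
  have h2 := aux x.2 y.2 ‖x - y‖ ((abs_snd_le x).trans hx) ((abs_snd_le y).trans hy)
    (abs_snd_le (x - y))
  unfold gauss gaussLip
  rw [← mul_sub, abs_mul, abs_of_nonneg (by positivity : 0 ≤ (σ ^ 2)⁻¹), mul_assoc]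
  refine mul_le_mul_of_nonneg_left ?_ (by positivity)
  rw [neg_div, neg_div]
  refine (abs_exp_neg_sub_exp_neg_le (by positivity) (by positivity)).trans ?_
  rw [← sub_div, abs_div, abs_of_nonneg (by positivity : 0 ≤ 2 * σ ^ 2), div_mul_eq_mul_div]
  gcongr
  rw [show x.1 ^ 2 + x.2 ^ 2 - (y.1 ^ 2 + y.2 ^ 2) =
    (x.1 ^ 2 - y.1 ^ 2) + (x.2 ^ 2 - y.2 ^ 2) by ring]
  exact (abs_add_le _ _).trans (by linarith)

/-! ### Areas of squares and of the square annulus. -/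

theorem volume_ball_plane (x : ℝ × ℝ) (r : ℝ) :
    volume (Metric.ball x r) = ENNReal.ofReal (2 * r) * ENNReal.ofReal (2 * r) := by
  rw [← Prod.mk.eta (p := x), ← ball_prod_same, Measure.volume_eq_prod, Measure.prod_prod,
    Real.volume_ball, Real.volume_ball]

theorem volume_closedBall_plane (x : ℝ × ℝ) (r : ℝ) :
    volume (Metric.closedBall x r) = ENNReal.ofReal (2 * r) * ENNReal.ofReal (2 * r) := by
  rw [← Prod.mk.eta (p := x), ← closedBall_prod_same, Measure.volume_eq_prod, Measure.prod_prod,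
    Real.volume_closedBall, Real.volume_closedBall]

/-- The square annulus `w - 2h ≤ |z|_∞ ≤ w + 2h`. -/
def shell (w h : ℝ) : Set (ℝ × ℝ) := {z | w - 2 * h ≤ ‖z‖ ∧ ‖z‖ ≤ w + 2 * h}

theorem measurableSet_shell (w h : ℝ) : MeasurableSet (shell w h) :=
  (measurableSet_le measurable_const measurable_norm).inter
    (measurableSet_le measurable_norm measurable_const)

theorem neg_mem_shell {w h : ℝ} {z : ℝ × ℝ} : -z ∈ shell w h ↔ z ∈ shell w h := by
  simp [shell]

theorem volume_translated_shell_le {w h : ℝ} (hh : 0 ≤ h) (hwh : 2 * h ≤ w) (x : ℝ × ℝ) :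
    volume {y | x - y ∈ shell w h} ≤ ENNReal.ofReal (32 * w * h) := by
  have hsub : {y | x - y ∈ shell w h} ⊆
      Metric.closedBall x (w + 2 * h) \ Metric.ball x (w - 2 * h) := by
    intro y hy
    simp only [Set.mem_sdiff, Metric.mem_closedBall, Metric.mem_ball, dist_comm y x, dist_eq_norm]
    exact ⟨hy.2, not_lt.2 hy.1⟩
  refine (measure_mono hsub).trans ?_
  -- The area is `4 (w + 2h)² - 4 (w - 2h)² = 32 w h`; `2h ≤ w` keeps the inner radius from being
  -- truncated by `ENNReal.ofReal`.
  rw [measure_sdiff (Metric.ball_subset_closedBall.trans (Metric.closedBall_subset_closedBall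
    (by linarith))) measurableSet_ball.nullMeasurableSet (measure_ball_lt_top).ne,
    volume_closedBall_plane, volume_ball_plane, ← ENNReal.ofReal_mul (by linarith),
    ← ENNReal.ofReal_mul (by linarith), ← ENNReal.ofReal_sub _ (by nlinarith)]
  exact ENNReal.ofReal_le_ofReal (by nlinarith)

/-! ### The grid and its step functions. -/

theorem gridSize_pos {n : ℕ} (hn : 0 < n) : 0 < gridSize n := by unfold gridSize; positivity

theorem gridSize_nonneg (n : ℕ) : 0 ≤ gridSize n := by unfold gridSize; positivity

theorem mul_gridSize {n : ℕ} (hn : 0 < n) : (n : ℝ) * gridSize n = 1 := by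
  unfold gridSize; field_simp

theorem measurableSet_unitSquare : MeasurableSet unitSquare :=
  measurableSet_Ioo.prod measurableSet_Ioo

theorem volume_unitSquare : volume unitSquare = 1 := by
  simp [unitSquare, Measure.volume_eq_prod, Measure.prod_prod, Real.volume_Ioo]

instance isProbabilityMeasure_areaΩ : IsProbabilityMeasure areaΩ :=
  ⟨by rw [areaΩ, Measure.restrict_apply_univ, volume_unitSquare]⟩

theorem measurableSet_cell (n : ℕ) (k : Fin n × Fin n) : MeasurableSet (cell n k) :=
  measurableSet_Ioo.prod measurableSet_Ioo

theorem volume_cell (n : ℕ) (k : Fin n × Fin n) :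
    volume (cell n k) = ENNReal.ofReal (gridSize n ^ 2) := by
  rw [cell, Measure.volume_eq_prod, Measure.prod_prod, Real.volume_Ioo, Real.volume_Ioo, sq,
    ENNReal.ofReal_mul (gridSize_nonneg n)]
  congr 2 <;> ring

theorem cell_subset_unitSquare (n : ℕ) (k : Fin n × Fin n) : cell n k ⊆ unitSquare := by
  have hn : 0 < n := k.1.pos
  have aux : ∀ i : Fin n, Set.Ioo ((i : ℝ) * gridSize n) (((i : ℝ) + 1) * gridSize n) ⊆
      Set.Ioo 0 1 := by
    intro i
    have h0 := gridSize_nonneg n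
    refine Set.Ioo_subset_Ioo (by positivity) ?_
    refine (mul_le_mul_of_nonneg_right ?_ h0).trans_eq (mul_gridSize hn)
    exact_mod_cast i.isLt
  exact Set.prod_mono (aux k.1) (aux k.2)

theorem node_mem_cell (n : ℕ) (k : Fin n × Fin n) : node n k ∈ cell n k := by
  have h0 := gridSize_pos k.1.pos
  refine ⟨⟨?_, ?_⟩, ⟨?_, ?_⟩⟩ <;> simp only [node] <;> gcongr <;> linarith

theorem node_mem_unitSquare (n : ℕ) (k : Fin n × Fin n) : node n k ∈ unitSquare :=
  cell_subset_unitSquare n k (node_mem_cell n k)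

theorem norm_sub_le_one {x y : ℝ × ℝ} (hx : x ∈ unitSquare) (hy : y ∈ unitSquare) :
    ‖x - y‖ ≤ 1 := by
  obtain ⟨⟨a1, a2⟩, a3, a4⟩ := hx
  obtain ⟨⟨b1, b2⟩, b3, b4⟩ := hy
  refine max_le ?_ ?_ <;> rw [Real.norm_eq_abs, abs_le] <;> simp only [Prod.fst_sub, Prod.snd_sub]
    <;> constructor <;> linarith

theorem norm_sub_node_le {n : ℕ} {k : Fin n × Fin n} {x : ℝ × ℝ} (hx : x ∈ cell n k) :
    ‖x - node n k‖ ≤ gridSize n / 2 := by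
  obtain ⟨⟨a1, a2⟩, a3, a4⟩ := hx
  refine max_le ?_ ?_ <;> rw [Real.norm_eq_abs, abs_le] <;>
    simp only [Prod.fst_sub, Prod.snd_sub, node] <;> constructor <;> linarith

theorem eq_of_mem_cell {n : ℕ} {k l : Fin n × Fin n} {x : ℝ × ℝ} (hk : x ∈ cell n k)
    (hl : x ∈ cell n l) : k = l := by
  have h0 := gridSize_pos k.1.pos
  have aux : ∀ (i j : Fin n) (t : ℝ),
      t ∈ Set.Ioo ((i : ℝ) * gridSize n) (((i : ℝ) + 1) * gridSize n) →
      t ∈ Set.Ioo ((j : ℝ) * gridSize n) (((j : ℝ) + 1) * gridSize n) → i = j := by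
    intro i j t hi hj
    have h1 := lt_of_mul_lt_mul_right (hi.1.trans hj.2) h0.le
    have h2 := lt_of_mul_lt_mul_right (hj.1.trans hi.2) h0.le
    norm_cast at h1 h2
    exact Fin.ext (by omega)
  exact Prod.ext (aux _ _ _ hk.1 hl.1) (aux _ _ _ hk.2 hl.2)

theorem stepFunction_apply (n : ℕ) (c : Fin n × Fin n → ℝ) (x : ℝ × ℝ) :
    stepFunction n c x = ∑ k, (cell n k).indicator (fun _ => c k) x := rfl

theorem stepFunction_of_mem {n : ℕ} (c : Fin n × Fin n → ℝ) {k : Fin n × Fin n} {x : ℝ × ℝ}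
    (hx : x ∈ cell n k) : stepFunction n c x = c k := by
  rw [stepFunction_apply, Finset.sum_eq_single k, Set.indicator_of_mem hx]
  · intro l _ hl
    exact Set.indicator_of_notMem (fun h => hl (eq_of_mem_cell h hx)) _
  · simp

theorem stepFunction_of_forall_notMem {n : ℕ} (c : Fin n × Fin n → ℝ) {x : ℝ × ℝ}
    (hx : ∀ k, x ∉ cell n k) : stepFunction n c x = 0 := by
  rw [stepFunction_apply]
  exact Finset.sum_eq_zero fun k _ => Set.indicator_of_notMem (hx k) _

theorem measurable_stepFunction (n : ℕ) (c : Fin n × Fin n → ℝ) :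
    Measurable (stepFunction n c) := by
  have : stepFunction n c = fun x => ∑ k, (cell n k).indicator (fun _ => c k) x := rfl
  rw [this]
  exact Finset.measurable_sum _ fun k _ => measurable_const.indicator (measurableSet_cell n k)

theorem integrable_stepFunction (n : ℕ) (c : Fin n × Fin n → ℝ) :
    Integrable (stepFunction n c) areaΩ := by
  have : stepFunction n c = fun x => ∑ k, (cell n k).indicator (fun _ => c k) x := rfl
  rw [this]
  exact integrable_finsetSum _ fun k _ => (integrable_const _).indicator (measurableSet_cell n k)

/-- Rewrites nodal sums as integrals, so that the discrete and continuous operators can be compared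
under one integral sign. -/
theorem integral_stepFunction (n : ℕ) (c : Fin n × Fin n → ℝ) :
    ∫ x, stepFunction n c x ∂areaΩ = gridSize n ^ 2 * ∑ k, c k := by
  simp only [stepFunction_apply]
  rw [integral_finsetSum _ fun k _ => (integrable_const _).indicator (measurableSet_cell n k),
    Finset.mul_sum]
  refine Finset.sum_congr rfl fun k _ => ?_
  rw [integral_indicator_const _ (measurableSet_cell n k), areaΩ, measureReal_def,
    Measure.restrict_apply (measurableSet_cell n k),
    Set.inter_eq_left.2 (cell_subset_unitSquare n k), volume_cell,
    ENNReal.toReal_ofReal (by positivity), smul_eq_mul]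

/-- The `n²` disjoint open cells of area `h²` have total area 1, that of `Ω`. -/
theorem ae_mem_cell {n : ℕ} (hn : 0 < n) : ∀ᵐ x ∂areaΩ, ∃ k, x ∈ cell n k := by
  have hm : MeasurableSet (⋃ k, cell n k) := MeasurableSet.iUnion (measurableSet_cell n)
  have hsub : (⋃ k, cell n k) ⊆ unitSquare := Set.iUnion_subset (cell_subset_unitSquare n)
  have hvol : volume (⋃ k, cell n k) = 1 := by
    rw [measure_iUnion (fun k l hkl => Set.disjoint_left.2 fun x hk hl =>
      hkl (eq_of_mem_cell hk hl)) (measurableSet_cell n), tsum_fintype]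
    simp only [volume_cell, Finset.sum_const, Finset.card_univ, Fintype.card_prod,
      Fintype.card_fin, nsmul_eq_mul]
    rw [← ENNReal.ofReal_natCast, ← ENNReal.ofReal_mul (by positivity), ← ENNReal.ofReal_one]
    congr 1
    have := mul_gridSize hn
    push_cast
    linear_combination ((n : ℝ) * gridSize n + 1) * this
  have hae := ae_eq_of_subset_of_measure_ge hsub (by rw [hvol, volume_unitSquare])
    hm.nullMeasurableSet (by rw [volume_unitSquare]; simp)
  rw [areaΩ, ae_restrict_iff' measurableSet_unitSquare]
  filter_upwards [hae] with x hx hxΩ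
  have : x ∈ ⋃ k, cell n k := (iff_of_eq hx).2 hxΩ
  simpa using this

/-! ### The unnormalized kernels and their pointwise difference. -/

open Classical in
/-- The unnormalized restricted blurring kernel. -/
def blurKernel (σ w : ℝ) (x y : ℝ × ℝ) : ℝ := if ‖x - y‖ < w then gauss σ (x - y) else 0

/-- The unnormalized discrete blurring kernel. -/
def discreteKernel (σ w : ℝ) (n : ℕ) (k l : Fin n × Fin n) : ℝ :=
  if l ∈ neighbours w n k then gauss σ (node n k - node n l) else 0

/-- The mass `∫_{|x|_∞ < w} G_σ(x) dx`. -/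
def blurMass (σ w : ℝ) : ℝ := ∫ x in {x : ℝ × ℝ | ‖x‖ < w}, gauss σ x

theorem measurableSet_norm_sub_lt (w : ℝ) (x : ℝ × ℝ) :
    MeasurableSet {y : ℝ × ℝ | ‖x - y‖ < w} :=
  measurableSet_lt (by fun_prop) measurable_const

theorem measurable_blurKernel (σ w : ℝ) (x : ℝ × ℝ) : Measurable (blurKernel σ w x) := by
  unfold blurKernel
  exact Measurable.ite (measurableSet_norm_sub_lt w x)
    ((continuous_gauss σ).measurable.comp (by fun_prop)) measurable_const

theorem blurKernel_nonneg (σ w : ℝ) (x y : ℝ × ℝ) : 0 ≤ blurKernel σ w x y := by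
  unfold blurKernel; split_ifs
  · exact gauss_nonneg _ _
  · exact le_rfl

theorem blurKernel_le (σ w : ℝ) (x y : ℝ × ℝ) : blurKernel σ w x y ≤ (σ ^ 2)⁻¹ := by
  unfold blurKernel; split_ifs
  · exact gauss_le _ _
  · positivity

theorem discreteKernel_nonneg (σ w : ℝ) (n : ℕ) (k l : Fin n × Fin n) :
    0 ≤ discreteKernel σ w n k l := by
  unfold discreteKernel; split_ifs
  · exact gauss_nonneg _ _
  · exact le_rfl

theorem discreteKernel_le (σ w : ℝ) (n : ℕ) (k l : Fin n × Fin n) :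
    discreteKernel σ w n k l ≤ (σ ^ 2)⁻¹ := by
  unfold discreteKernel; split_ifs
  · exact gauss_le _ _
  · positivity

theorem blur_eq (σ w : ℝ) (u : ℝ × ℝ → ℝ) (x : ℝ × ℝ) :
    blur σ w u x = (blurMass σ w)⁻¹ * ∫ y, blurKernel σ w x y * u y ∂areaΩ := by
  have hπ := Real.pi_pos
  have h1 : (alpha σ w)⁻¹ * (2 * Real.pi)⁻¹ = (blurMass σ w)⁻¹ := by
    rw [alpha, ← blurMass, mul_inv]
    field_simp
  rw [blur, h1, areaΩ, ← integral_indicator (measurableSet_norm_sub_lt w x),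
    ← integral_indicator measurableSet_unitSquare]
  congr 2
  funext y
  by_cases hy : y ∈ unitSquare <;> by_cases hw : ‖x - y‖ < w <;>
    simp [blurKernel, hy, hw]

/-- Pointwise bound for the difference of the unnormalized kernels. -/
def kernelError (σ w : ℝ) (n : ℕ) (z : ℝ × ℝ) : ℝ :=
  gaussLip σ * gridSize n + (shell w (gridSize n)).indicator (fun _ => (σ ^ 2)⁻¹) z

theorem kernelError_nonneg (σ w : ℝ) (n : ℕ) (z : ℝ × ℝ) : 0 ≤ kernelError σ w n z :=
  add_nonneg (mul_nonneg (gaussLip_nonneg σ) (gridSize_nonneg n))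
    (Set.indicator_nonneg (fun _ _ => by positivity) _)

theorem measurable_kernelError (σ w : ℝ) (n : ℕ) : Measurable (kernelError σ w n) :=
  measurable_const.add (measurable_const.indicator (measurableSet_shell _ _))

theorem kernelError_neg (σ w : ℝ) (n : ℕ) (z : ℝ × ℝ) :
    kernelError σ w n (-z) = kernelError σ w n z := by
  unfold kernelError
  congr 1
  by_cases hz : z ∈ shell w (gridSize n)
  · rw [Set.indicator_of_mem hz, Set.indicator_of_mem (neg_mem_shell.2 hz)]
  · rw [Set.indicator_of_notMem hz, Set.indicator_of_notMem (mt neg_mem_shell.1 hz)]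

theorem mem_neighbours {w : ℝ} {n : ℕ} {k l : Fin n × Fin n} :
    l ∈ neighbours w n k ↔ ∃ y ∈ cell n l, ‖y - node n k‖ < w := by
  simp only [neighbours, Finset.mem_filter, Finset.mem_univ, true_and]
  constructor
  · rintro ⟨y, hy, _, h⟩
    exact ⟨y, hy, h⟩
  · rintro ⟨y, hy, h⟩
    exact ⟨y, hy, cell_subset_unitSquare n l hy, h⟩

/-- Each point is within `h/2` of its node. If both cutoffs are on, the arguments of `G_σ` differ by
at most `h`. If they disagree, the triangle inequality through the nodes puts `|x - y|_∞` between `w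
- h/2` and `w + 3h/2`, inside the shell, where the bound `σ⁻²` is enough. -/
theorem abs_blurKernel_sub_discreteKernel_le (σ w : ℝ) {n : ℕ} {k l : Fin n × Fin n}
    {x y : ℝ × ℝ} (hx : x ∈ cell n k) (hy : y ∈ cell n l) :
    |blurKernel σ w x y - discreteKernel σ w n k l| ≤ kernelError σ w n (x - y) := by
  have h0 := gridSize_pos k.1.pos
  have hL : 0 ≤ gaussLip σ * gridSize n := mul_nonneg (gaussLip_nonneg σ) h0.le
  have hi : 0 ≤ (shell w (gridSize n)).indicator (fun _ => (σ ^ 2)⁻¹) (x - y) :=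
    Set.indicator_nonneg (fun _ _ => by positivity) _
  have hxk := norm_sub_node_le hx
  have hyl := norm_sub_node_le hy
  by_cases hw : ‖x - y‖ < w <;> by_cases hl : l ∈ neighbours w n k
  · rw [blurKernel, if_pos hw, discreteKernel, if_pos hl, kernelError]
    have h1 := abs_gauss_sub_gauss_le σ
      (norm_sub_le_one (cell_subset_unitSquare n k hx) (cell_subset_unitSquare n l hy))
      (norm_sub_le_one (node_mem_unitSquare n k) (node_mem_unitSquare n l))
    have h2 : ‖x - y - (node n k - node n l)‖ ≤ gridSize n := by
      rw [sub_sub_sub_comm]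
      exact (norm_sub_le _ _).trans (by linarith)
    have h3 := mul_le_mul_of_nonneg_left h2 (gaussLip_nonneg σ)
    linarith
  · have hs : x - y ∈ shell w (gridSize n) := by
      have h1 : w ≤ ‖y - node n k‖ := not_lt.1 fun h => hl (mem_neighbours.2 ⟨y, hy, h⟩)
      have h2 : ‖y - node n k‖ ≤ ‖x - node n k‖ + ‖x - y‖ := by
        rw [show y - node n k = (x - node n k) - (x - y) by abel]
        exact norm_sub_le _ _
      constructor <;> linarith
    rw [discreteKernel, if_neg hl, sub_zero, abs_of_nonneg (blurKernel_nonneg _ _ _ _),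
      kernelError, Set.indicator_of_mem hs]
    have := blurKernel_le σ w x y
    linarith
  · have hs : x - y ∈ shell w (gridSize n) := by
      obtain ⟨y', hy', h1⟩ := mem_neighbours.1 hl
      have h3 := norm_sub_node_le hy'
      have h2 : ‖x - y‖ ≤ ‖x - node n k‖ + ‖y' - node n k‖ + ‖y' - node n l‖ +
          ‖y - node n l‖ := by
        rw [show x - y = (x - node n k) - (y' - node n k) + (y' - node n l) - (y - node n l) by
          abel]
        exact (norm_sub_le _ _).trans (add_le_add_left ((norm_add_le _ _).trans
          (add_le_add_left (norm_sub_le _ _) _)) _)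
      constructor <;> linarith
    rw [blurKernel, if_neg hw, zero_sub, abs_neg, abs_of_nonneg (discreteKernel_nonneg _ _ _ _ _),
      kernelError, Set.indicator_of_mem hs]
    have := discreteKernel_le σ w n k l
    linarith
  · rw [blurKernel, if_neg hw, discreteKernel, if_neg hl, sub_zero, abs_zero]
    exact kernelError_nonneg _ _ _ _

/-- The constant in the bound of the integral of `kernelError`. -/
def kernelErrorConst (σ w : ℝ) : ℝ := gaussLip σ + (σ ^ 2)⁻¹ * (32 * w)

theorem lintegral_kernelError_le (σ : ℝ) {w : ℝ} {n : ℕ} (hw : 2 * gridSize n ≤ w) (x : ℝ × ℝ) :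
    ∫⁻ y, ENNReal.ofReal (kernelError σ w n (x - y)) ∂areaΩ ≤
      ENNReal.ofReal (kernelErrorConst σ w * gridSize n) := by
  have h0 := gridSize_nonneg n
  have hL : 0 ≤ gaussLip σ * gridSize n := mul_nonneg (gaussLip_nonneg σ) h0
  have hw0 : 0 ≤ w := by linarith
  have hs : MeasurableSet {y | x - y ∈ shell w (gridSize n)} :=
    (measurableSet_shell w (gridSize n)).preimage (measurable_const.sub measurable_id)
  have h1 : ∀ y, ENNReal.ofReal (kernelError σ w n (x - y)) =
      ENNReal.ofReal (gaussLip σ * gridSize n) +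
        {y | x - y ∈ shell w (gridSize n)}.indicator (fun _ => ENNReal.ofReal (σ ^ 2)⁻¹) y := by
    intro y
    rw [kernelError, ENNReal.ofReal_add hL (Set.indicator_nonneg (fun _ _ => by positivity) _)]
    congr 1
    by_cases h : x - y ∈ shell w (gridSize n)
    · rw [Set.indicator_of_mem h, Set.indicator_of_mem (show y ∈ {y | x - y ∈ shell w (gridSize n)} from h)]
    · rw [Set.indicator_of_notMem h, Set.indicator_of_notMem (show y ∉ {y | x - y ∈ shell w (gridSize n)} from h),
        ENNReal.ofReal_zero]
  simp_rw [h1]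
  rw [lintegral_add_left measurable_const, lintegral_const, measure_univ, mul_one,
    lintegral_indicator_const hs, kernelErrorConst, add_mul,
    ENNReal.ofReal_add hL (by positivity), mul_assoc (σ ^ 2)⁻¹,
    ENNReal.ofReal_mul (p := (σ ^ 2)⁻¹) (by positivity)]
  gcongr
  exact (Measure.restrict_apply_le _ _).trans (volume_translated_shell_le h0 hw x)

/-! ### Stencils, interior cells and the discrete mass. -/

/-- The number of grid cells by which neighbours may be apart in each direction. -/
def reach (w : ℝ) (n : ℕ) : ℤ := ⌈w / gridSize n - 1 / 2⌉

theorem reach_nonneg {w : ℝ} (hw : 0 < w) (n : ℕ) : 0 ≤ reach w n := by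
  have : 0 ≤ w / gridSize n := div_nonneg hw.le (gridSize_nonneg n)
  have h : (-1 : ℤ) < reach w n := Int.lt_ceil.2 (by push_cast; linarith)
  omega

theorem lt_reach_iff {w : ℝ} {n : ℕ} (hn : 0 < n) (z : ℤ) :
    z < reach w n ↔ (z + 1 / 2) * gridSize n < w := by
  rw [reach, Int.lt_ceil, lt_sub_iff_add_lt, lt_div_iff₀ (gridSize_pos hn)]

/-- For `i ≠ j`, the edge of interval `i` nearest to the center of interval `j` is at distance `(|i
- j| - 1/2) h`. The open interval comes within `w` of that center iff this is less than `w`, which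
`lt_reach_iff` reads as `|i - j| - 1 < reach w n`. -/
theorem exists_mem_Ioo_abs_sub_lt_iff {w : ℝ} (hw : 0 < w) {n : ℕ} (hn : 0 < n) (i j : ℤ) :
    (∃ t ∈ Set.Ioo ((i : ℝ) * gridSize n) ((i + 1) * gridSize n),
      |t - (j + 1 / 2) * gridSize n| < w) ↔ |i - j| ≤ reach w n := by
  have h0 := gridSize_pos hn
  have h1 := lt_reach_iff (w := w) hn (i - j - 1)
  have h2 := lt_reach_iff (w := w) hn (j - i - 1)
  push_cast at h1 h2
  rw [abs_le]
  constructor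
  · rintro ⟨t, ⟨ht1, ht2⟩, ht⟩
    rw [abs_lt] at ht
    have := h1.2 (by linarith [ht.2])
    have := h2.2 (by linarith [ht.1])
    omega
  · rintro ⟨ha, hb⟩
    have h3 := h1.1 (by omega)
    have h4 := h2.1 (by omega)
    obtain ⟨t, ht⟩ : (Set.Ioo (max (i * gridSize n) ((j + 1 / 2) * gridSize n - w))
        (min ((i + 1) * gridSize n) ((j + 1 / 2) * gridSize n + w))).Nonempty := by
      rw [Set.nonempty_Ioo, max_lt_iff, lt_min_iff, lt_min_iff]
      refine ⟨⟨?_, ?_⟩, ?_, ?_⟩ <;> linarith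
    obtain ⟨hl, hr⟩ := ht
    rw [max_lt_iff] at hl
    rw [lt_min_iff] at hr
    exact ⟨t, ⟨hl.1, hr.1⟩, abs_lt.2 ⟨by linarith [hl.2], by linarith [hr.2]⟩⟩

/-- Cells and maximum-norm balls are both products, so the condition splits by coordinate: `N_k` is
a square block of indices, cut off only by the boundary of the grid. -/
theorem mem_neighbours_iff {w : ℝ} (hw : 0 < w) {n : ℕ} {k l : Fin n × Fin n} :
    l ∈ neighbours w n k ↔ |(l.1 : ℤ) - (k.1 : ℤ)| ≤ reach w n ∧
      |(l.2 : ℤ) - (k.2 : ℤ)| ≤ reach w n := by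
  have hn : 0 < n := k.1.pos
  rw [mem_neighbours, ← exists_mem_Ioo_abs_sub_lt_iff hw hn, ← exists_mem_Ioo_abs_sub_lt_iff hw hn]
  constructor
  · rintro ⟨y, hy, h⟩
    have h1 : |y.1 - _| < w := (abs_fst_le _).trans_lt h
    have h2 : |y.2 - _| < w := (abs_snd_le _).trans_lt h
    exact ⟨⟨y.1, by simpa using hy.1, by simpa [node] using h1⟩,
      ⟨y.2, by simpa using hy.2, by simpa [node] using h2⟩⟩
  · rintro ⟨⟨s, hs, hs'⟩, t, ht, ht'⟩
    refine ⟨(s, t), ⟨by simpa using hs, by simpa using ht⟩, max_lt ?_ ?_⟩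
    · simpa [node] using hs'
    · simpa [node] using ht'

/-- The cell `R_k` has its full stencil of neighbours inside `Ω`. -/
def IsInterior (w : ℝ) (n : ℕ) (k : Fin n × Fin n) : Prop :=
  (reach w n ≤ (k.1 : ℤ) ∧ (k.1 : ℤ) + reach w n + 1 ≤ n) ∧
    (reach w n ≤ (k.2 : ℤ) ∧ (k.2 : ℤ) + reach w n + 1 ≤ n)

theorem setOf_norm_sub_lt (x : ℝ × ℝ) (r : ℝ) :
    {y : ℝ × ℝ | ‖y - x‖ < r} =
      Set.Ioo (x.1 - r) (x.1 + r) ×ˢ Set.Ioo (x.2 - r) (x.2 + r) := by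
  rw [← Real.ball_eq_Ioo, ← Real.ball_eq_Ioo, ball_prod_same]
  ext y
  rw [Set.mem_ofPred_eq, Metric.mem_ball, dist_eq_norm]

/-- In each coordinate, with `m = reach w n`, the square of radius `w_h` ends at the grid lines `(k
- m) h` and `(k + m + 1) h`. -/
theorem square_subset_unitSquare_iff {w : ℝ} (hw : 0 < w) {n : ℕ} (k : Fin n × Fin n) :
    {y : ℝ × ℝ | ‖y - node n k‖ < discreteWidth w n} ⊆ unitSquare ↔ IsInterior w n k := by
  have hn : 0 < n := k.1.pos
  have h0 := gridSize_pos hn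
  have hm : (0 : ℝ) ≤ reach w n := by exact_mod_cast reach_nonneg hw n
  have hd : discreteWidth w n = (reach w n + 1 / 2) * gridSize n := rfl
  have hpos : 0 < discreteWidth w n := by rw [hd]; positivity
  have aux : ∀ i : Fin n, Set.Ioo (((i : ℝ) + 1 / 2) * gridSize n - discreteWidth w n)
      (((i : ℝ) + 1 / 2) * gridSize n + discreteWidth w n) ⊆ Set.Ioo 0 1 ↔
      reach w n ≤ (i : ℤ) ∧ (i : ℤ) + reach w n + 1 ≤ n := by
    intro i
    rw [Set.Ioo_subset_Ioo_iff (by linarith), hd]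
    refine and_congr ?_ ?_
    · rw [show ((i : ℝ) + 1 / 2) * gridSize n - (reach w n + 1 / 2) * gridSize n =
        (i - reach w n) * gridSize n by ring, mul_nonneg_iff_of_pos_right h0, sub_nonneg]
      norm_cast
    · rw [show ((i : ℝ) + 1 / 2) * gridSize n + (reach w n + 1 / 2) * gridSize n =
        (i + reach w n + 1) * gridSize n by ring]
      have h1 := mul_le_mul_iff_left₀ (b := (i : ℝ) + reach w n + 1) (c := (n : ℝ)) h0
      rw [mul_gridSize hn] at h1
      rw [h1]
      norm_cast
  rw [setOf_norm_sub_lt, unitSquare, Set.prod_subset_prod_iff]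
  have h1 : (Set.Ioo ((node n k).1 - discreteWidth w n)
      ((node n k).1 + discreteWidth w n)).Nonempty := Set.nonempty_Ioo.2 (by linarith)
  have h2 : (Set.Ioo ((node n k).2 - discreteWidth w n)
      ((node n k).2 + discreteWidth w n)).Nonempty := Set.nonempty_Ioo.2 (by linarith)
  simp only [h1.ne_empty, h2.ne_empty, or_false]
  exact and_congr (aux k.1) (aux k.2)

theorem le_discreteWidth (w : ℝ) {n : ℕ} (hn : 0 < n) : w ≤ discreteWidth w n := by
  have := (lt_reach_iff (w := w) hn (reach w n)).not.1 (lt_irrefl _)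
  exact not_lt.1 this

/-- Without an interior cell the condition on `η` would be vacuous and uniqueness would fail. With
`m = reach w n`, `(m - 1/2) h < w` gives `(2m + 1) h < 2w + 2h ≤ 1`, so a full stencil fits around
the cell `(m, m)`. -/
theorem exists_isInterior {w : ℝ} (hw : 0 < w) {n : ℕ} (hn : 0 < n)
    (h : gridSize n ≤ (1 - 2 * w) / 2) : ∃ k, IsInterior w n k := by
  have h0 := gridSize_pos hn
  have hm := reach_nonneg hw n
  have h1 := (lt_reach_iff (w := w) hn (reach w n - 1)).1 (by omega)
  have h2 : 2 * reach w n + 1 < (n : ℤ) + 1 := by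
    have : (2 * (reach w n : ℝ) + 1) * gridSize n < (n + 1) * gridSize n := by
      have := mul_gridSize hn
      push_cast at h1
      linarith
    exact_mod_cast lt_of_mul_lt_mul_right this h0.le
  have h3 : (reach w n).toNat < n := by omega
  refine ⟨(⟨_, h3⟩, ⟨_, h3⟩), ?_⟩
  simp only [IsInterior]
  omega

/-- The discrete mass `h² ∑_{l ∈ N_k} G_σ(z_k - z_l)`, for `k` in the interior. -/
def discreteMass (σ w : ℝ) (n : ℕ) : ℝ :=
  gridSize n ^ 2 * ∑ d ∈ Finset.Icc (-reach w n) (reach w n) ×ˢ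
    Finset.Icc (-reach w n) (reach w n), gauss σ (-d.1 * gridSize n, -d.2 * gridSize n)

/-- The weights depend only on `l - k`, and an interior stencil is not cut off, so `l ↦ l - k` maps
it onto the whole block. Hence a single `η` serves every interior `k`. -/
theorem discreteMass_eq {w : ℝ} (hw : 0 < w) (σ : ℝ) {n : ℕ} {k : Fin n × Fin n}
    (hk : IsInterior w n k) :
    discreteMass σ w n =
      gridSize n ^ 2 * ∑ l ∈ neighbours w n k, gauss σ (node n k - node n l) := by
  rw [discreteMass]
  congr 1
  symm
  refine Finset.sum_nbij (fun l => ((l.1 : ℤ) - (k.1 : ℤ), (l.2 : ℤ) - (k.2 : ℤ))) ?_ ?_ ?_ ?_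
  · intro l hl
    have := (mem_neighbours_iff hw).1 hl
    simp only [Finset.mem_product, Finset.mem_Icc]
    exact ⟨abs_le.1 this.1, abs_le.1 this.2⟩
  · intro l _ l' _ h
    simp only [Prod.mk.injEq] at h
    exact Prod.ext (Fin.ext (by omega)) (Fin.ext (by omega))
  · intro d hd
    simp only [Finset.coe_product, Finset.coe_Icc, Set.mem_prod, Set.mem_Icc] at hd
    obtain ⟨⟨h1, h2⟩, h3, h4⟩ := hk
    have a1 : (d.1 + (k.1 : ℤ)).toNat < n := by omega
    have a2 : (d.2 + (k.2 : ℤ)).toNat < n := by omega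
    have b1 : ((d.1 + (k.1 : ℤ)).toNat : ℤ) = d.1 + k.1 := Int.toNat_of_nonneg (by omega)
    have b2 : ((d.2 + (k.2 : ℤ)).toNat : ℤ) = d.2 + k.2 := Int.toNat_of_nonneg (by omega)
    refine ⟨(⟨_, a1⟩, ⟨_, a2⟩), ?_, ?_⟩
    · rw [Finset.mem_coe, mem_neighbours_iff hw]
      simp only [b1, b2, abs_le]
      omega
    · ext <;> simp only [b1, b2] <;> ring
  · intro l _
    congr 1
    ext <;> simp only [node, Prod.fst_sub, Prod.snd_sub] <;> push_cast <;> ring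

theorem discreteMass_eq_sum_discreteKernel {w : ℝ} (hw : 0 < w) (σ : ℝ) {n : ℕ}
    {k : Fin n × Fin n} (hk : IsInterior w n k) :
    discreteMass σ w n = gridSize n ^ 2 * ∑ l, discreteKernel σ w n k l := by
  rw [discreteMass_eq hw σ hk]
  simp only [discreteKernel]
  rw [Finset.sum_ite_mem, Finset.univ_inter]

/-! ### Lower bounds for the masses. -/

theorem gauss_integrableOn {s : Set (ℝ × ℝ)} (σ : ℝ) (hs : volume s ≠ ∞) :
    IntegrableOn (gauss σ) s := by
  refine Measure.integrableOn_of_bounded hs (continuous_gauss σ).aestronglyMeasurable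
    (M := (σ ^ 2)⁻¹) (Filter.Eventually.of_forall fun x => ?_)
  rw [Real.norm_of_nonneg (gauss_nonneg σ x)]
  exact gauss_le σ x

theorem setOf_norm_lt (w : ℝ) : {x : ℝ × ℝ | ‖x‖ < w} = Metric.ball 0 w := by
  ext x; simp

theorem volumeReal_ball_plane (x : ℝ × ℝ) {r : ℝ} (hr : 0 ≤ r) :
    volume.real (Metric.ball x r) = 4 * r ^ 2 := by
  rw [measureReal_def, volume_ball_plane, ← ENNReal.ofReal_mul (by positivity),
    ENNReal.toReal_ofReal (by positivity)]
  ring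

theorem alpha_pos {σ : ℝ} (hσ : 0 < σ) {w : ℝ} (hw : 0 < w) : 0 < alpha σ w := by
  have hπ := Real.pi_pos
  refine mul_pos (by positivity) ?_
  rw [setOf_norm_lt, setIntegral_pos_iff_support_of_nonneg_ae
    (Filter.Eventually.of_forall (gauss_nonneg σ))
    (gauss_integrableOn σ measure_ball_lt_top.ne)]
  have : Function.support (gauss σ) = Set.univ :=
    Set.eq_univ_of_forall fun x => (gauss_pos hσ x).ne'
  rw [this, Set.univ_inter]
  exact Metric.measure_ball_pos _ _ hw

/-- A common lower bound of the masses of the kernels. -/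
def massMin (σ w : ℝ) : ℝ := 4 * w ^ 2 * gaussMin σ

theorem massMin_pos {σ : ℝ} (hσ : 0 < σ) {w : ℝ} (hw : 0 < w) : 0 < massMin σ w := by
  have := gaussMin_pos hσ
  unfold massMin; positivity

theorem massMin_le_blurMass (σ : ℝ) {w : ℝ} (hw : 0 ≤ w) (hw' : w ≤ 1) :
    massMin σ w ≤ blurMass σ w := by
  rw [blurMass, setOf_norm_lt, massMin, ← volumeReal_ball_plane 0 hw, ← smul_eq_mul,
    ← setIntegral_const]
  refine setIntegral_mono_on (integrableOn_const measure_ball_lt_top.ne)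
    (gauss_integrableOn σ measure_ball_lt_top.ne) measurableSet_ball fun x hx => ?_
  exact gaussMin_le σ ((mem_ball_zero_iff.1 hx).le.trans hw')

theorem ball_node_subset {w : ℝ} (hw : 0 < w) {n : ℕ} {k : Fin n × Fin n}
    (hk : IsInterior w n k) : Metric.ball (node n k) w ⊆ unitSquare := by
  refine subset_trans ?_ ((square_subset_unitSquare_iff hw k).2 hk)
  intro y hy
  rw [Metric.mem_ball, dist_eq_norm] at hy
  exact hy.trans_le (le_discreteWidth w k.1.pos)

theorem integral_stepFunction_discreteKernel {w : ℝ} (hw : 0 < w) (σ : ℝ) {n : ℕ}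
    {k : Fin n × Fin n} (hk : IsInterior w n k) :
    ∫ y, stepFunction n (discreteKernel σ w n k) y ∂areaΩ = discreteMass σ w n := by
  rw [integral_stepFunction, discreteMass_eq_sum_discreteKernel hw σ hk]

/-- Up to a null set the stencil cells cover the ball of radius `w` about `z_k`, since any cell
meeting it is a neighbour; there the discrete kernel is at least `gaussMin σ`. -/
theorem massMin_le_discreteMass (σ : ℝ) {w : ℝ} (hw : 0 < w) {n : ℕ} {k : Fin n × Fin n}
    (hk : IsInterior w n k) : massMin σ w ≤ discreteMass σ w n := by
  have hb := ball_node_subset hw hk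
  have h1 : massMin σ w =
      ∫ y, (Metric.ball (node n k) w).indicator (fun _ => gaussMin σ) y ∂areaΩ := by
    rw [integral_indicator_const _ measurableSet_ball, measureReal_def, areaΩ,
      Measure.restrict_apply measurableSet_ball, Set.inter_eq_left.2 hb, ← measureReal_def,
      volumeReal_ball_plane _ hw.le, smul_eq_mul, massMin]
  rw [h1, ← integral_stepFunction_discreteKernel hw σ hk]
  refine integral_mono_ae ((integrable_const _).indicator measurableSet_ball)
    (integrable_stepFunction _ _) ?_
  filter_upwards [ae_mem_cell k.1.pos] with y hy
  obtain ⟨l, hl⟩ := hy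
  rw [stepFunction_of_mem _ hl]
  by_cases hyb : y ∈ Metric.ball (node n k) w
  · rw [Set.indicator_of_mem hyb]
    rw [Metric.mem_ball, dist_eq_norm] at hyb
    rw [discreteKernel, if_pos (mem_neighbours.2 ⟨y, hl, hyb⟩)]
    exact gaussMin_le σ (norm_sub_le_one (node_mem_unitSquare n k) (node_mem_unitSquare n l))
  · rw [Set.indicator_of_notMem hyb]
    exact discreteKernel_nonneg _ _ _ _ _

/-! ### Comparison of the operators and of the masses. -/

theorem integral_blurKernel {w : ℝ} (σ : ℝ) {x : ℝ × ℝ} (hx : Metric.ball x w ⊆ unitSquare) :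
    ∫ y, blurKernel σ w x y ∂areaΩ = blurMass σ w := by
  have h1 : ∀ y ∉ unitSquare, blurKernel σ w x y = 0 := by
    intro y hy
    rw [blurKernel, if_neg]
    intro h
    exact hy (hx (by rwa [Metric.mem_ball, dist_comm, dist_eq_norm]))
  rw [areaΩ, setIntegral_eq_integral_of_forall_compl_eq_zero h1, blurMass,
    ← integral_indicator (measurableSet_lt measurable_norm measurable_const),
    ← integral_sub_left_eq_self ({x : ℝ × ℝ | ‖x‖ < w}.indicator (gauss σ)) volume x]
  congr 1

/-- Uses `A k - B k_h = (A - B) k + B (k - k_h)`. The factors are left free because the bound serves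
twice: with `A = B = 1` to compare the masses, then with the inverse masses to compare the
operators. -/
theorem enorm_blur_sub_discreteBlur_le (σ w A B : ℝ) {n : ℕ} {k : Fin n × Fin n} {x : ℝ × ℝ}
    (hx : x ∈ cell n k) (c : Fin n × Fin n → ℝ) :
    ‖A * ∫ y, blurKernel σ w x y * stepFunction n c y ∂areaΩ -
        B * (gridSize n ^ 2 * ∑ l, discreteKernel σ w n k l * c l)‖ₑ ≤
      ∫⁻ y, ENNReal.ofReal (|A - B| * (σ ^ 2)⁻¹ + |B| * kernelError σ w n (x - y)) *
        ‖stepFunction n c y‖ₑ ∂areaΩ := by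
  have hint : Integrable (fun y => blurKernel σ w x y * stepFunction n c y) areaΩ := by
    refine (integrable_stepFunction n c).bdd_mul
      (measurable_blurKernel σ w x).aestronglyMeasurable (c := (σ ^ 2)⁻¹)
      (Filter.Eventually.of_forall fun y => ?_)
    rw [Real.norm_of_nonneg (blurKernel_nonneg σ w x y)]
    exact blurKernel_le σ w x y
  rw [← integral_stepFunction n fun l => discreteKernel σ w n k l * c l, ← integral_const_mul,
    ← integral_const_mul, ← integral_sub (hint.const_mul A)
      ((integrable_stepFunction n _).const_mul B)]
  refine (enorm_integral_le_lintegral_enorm _).trans (lintegral_mono fun y => ?_)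
  by_cases hy : ∃ l, y ∈ cell n l
  · obtain ⟨l, hl⟩ := hy
    rw [stepFunction_of_mem _ hl, stepFunction_of_mem _ hl,
      show A * (blurKernel σ w x y * c l) - B * (discreteKernel σ w n k l * c l) =
        ((A - B) * blurKernel σ w x y + B * (blurKernel σ w x y - discreteKernel σ w n k l)) * c l
        by ring, enorm_mul]
    gcongr
    rw [Real.enorm_eq_ofReal_abs]
    refine ENNReal.ofReal_le_ofReal ((abs_add_le _ _).trans ?_)
    rw [abs_mul, abs_mul, abs_of_nonneg (blurKernel_nonneg σ w x y)]
    gcongr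
    · exact blurKernel_le σ w x y
    · exact abs_blurKernel_sub_discreteKernel_le σ w hx hl
  · have hy' : ∀ l, y ∉ cell n l := fun l hl => hy ⟨l, hl⟩
    simp [stepFunction_of_forall_notMem _ hy']

/-- At an interior node, applying the unnormalized operators to `u = 1` yields exactly the two
masses, so the kernel comparison bounds their difference. -/
theorem abs_blurMass_sub_discreteMass_le (σ : ℝ) {w : ℝ} (hw : 0 < w) {n : ℕ} {k : Fin n × Fin n}
    (hk : IsInterior w n k) (hn : 2 * gridSize n ≤ w) :
    |blurMass σ w - discreteMass σ w n| ≤ kernelErrorConst σ w * gridSize n := by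
  have h0 := gridSize_nonneg n
  have h := enorm_blur_sub_discreteBlur_le σ w 1 1 (node_mem_cell n k) (fun _ => 1)
  have hone : ∀ᵐ y ∂areaΩ, stepFunction n (fun _ => (1 : ℝ)) y = 1 := by
    filter_upwards [ae_mem_cell k.1.pos] with y hy
    obtain ⟨l, hl⟩ := hy
    exact stepFunction_of_mem _ hl
  have h1 : ∫ y, blurKernel σ w (node n k) y * stepFunction n (fun _ => (1 : ℝ)) y ∂areaΩ =
      blurMass σ w := by
    rw [← integral_blurKernel σ (ball_node_subset hw hk)]
    refine integral_congr_ae ?_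
    filter_upwards [hone] with y hy
    rw [hy, mul_one]
  have h2 : ∫⁻ y, ENNReal.ofReal (kernelError σ w n (node n k - y)) *
      ‖stepFunction n (fun _ => (1 : ℝ)) y‖ₑ ∂areaΩ =
      ∫⁻ y, ENNReal.ofReal (kernelError σ w n (node n k - y)) ∂areaΩ := by
    refine lintegral_congr_ae ?_
    filter_upwards [hone] with y hy
    rw [hy, enorm_one, mul_one]
  simp only [sub_self, abs_zero, zero_mul, zero_add, one_mul, abs_one, mul_one, h1, h2,
    ← discreteMass_eq_sum_discreteKernel hw σ hk] at h
  have h3 := h.trans (lintegral_kernelError_le σ hn _)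
  rw [Real.enorm_eq_ofReal_abs] at h3
  refine (ENNReal.ofReal_le_ofReal_iff (mul_nonneg ?_ h0)).1 h3
  exact add_nonneg (gaussLip_nonneg σ) (by positivity)

/-! ### Elimination of the renormalization parameter. -/

theorem sum_weight_eq (σ w : ℝ) (n : ℕ) (k : Fin n × Fin n) :
    ∑ l ∈ neighbours w n k, weight σ w n k l =
      (2 * alpha σ (discreteWidth w n) * Real.pi)⁻¹ *
        (gridSize n ^ 2 * ∑ l ∈ neighbours w n k, gauss σ (node n k - node n l)) := by
  simp only [weight, Finset.mul_sum]
  exact Finset.sum_congr rfl fun l _ => by ring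

/-- All interior cells impose the same linear equation on `η`, as the discrete mass does not depend
on `k`. -/
theorem isRenormalization_iff {σ w : ℝ} (hw : 0 < w) {n : ℕ} (hk : ∃ k, IsInterior w n k) (η : ℝ) :
    IsRenormalization σ w n η ↔
      (1 + η) * ((2 * alpha σ (discreteWidth w n) * Real.pi)⁻¹ * discreteMass σ w n) = 1 := by
  constructor
  · intro h
    obtain ⟨k, hk⟩ := hk
    have := h k ((square_subset_unitSquare_iff hw k).2 hk)
    rwa [sum_weight_eq, ← discreteMass_eq hw σ hk] at this
  · intro h k hsub
    rw [sum_weight_eq, ← discreteMass_eq hw σ ((square_subset_unitSquare_iff hw k).1 hsub)]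
    exact h

theorem discreteBlur_stepFunction {σ w : ℝ} {n : ℕ} {η : ℝ}
    (hη : (1 + η) * ((2 * alpha σ (discreteWidth w n) * Real.pi)⁻¹ * discreteMass σ w n) = 1)
    (u : piecewiseConstant n) (c : Fin n × Fin n → ℝ) (hu : stepFunction n c = u) :
    (discreteBlur σ w n η u : ℝ × ℝ → ℝ) = stepFunction n fun k =>
      (discreteMass σ w n)⁻¹ * (gridSize n ^ 2 * ∑ l, discreteKernel σ w n k l * c l) := by
  change stepFunction n (nodalBlur σ w n η u) = _
  congr 1
  funext k
  change (1 + η) * ∑ l ∈ neighbours w n k, weight σ w n k l * (u : ℝ × ℝ → ℝ) (node n l) = _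
  have h1 : (1 + η) * (2 * alpha σ (discreteWidth w n) * Real.pi)⁻¹ = (discreteMass σ w n)⁻¹ :=
    eq_inv_of_mul_eq_one_left (by rw [mul_assoc, hη])
  have h2 : ∑ l, discreteKernel σ w n k l * c l =
      ∑ l ∈ neighbours w n k, gauss σ (node n k - node n l) * c l := by
    simp only [discreteKernel, ite_mul, zero_mul]
    rw [Finset.sum_ite_mem, Finset.univ_inter]
  rw [h2, ← h1, ← hu, Finset.mul_sum, Finset.mul_sum, Finset.mul_sum]
  refine Finset.sum_congr rfl fun l _ => ?_
  rw [stepFunction_of_mem c (node_mem_cell n l), weight]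
  ring

/-! ### The two norm estimates. -/

theorem abs_inv_sub_inv_le {a b m : ℝ} (hm : 0 < m) (ha : m ≤ a) (hb : m ≤ b) :
    |a⁻¹ - b⁻¹| ≤ |a - b| / m ^ 2 := by
  have ha' := hm.trans_le ha
  have hb' := hm.trans_le hb
  rw [inv_sub_inv ha'.ne' hb'.ne', abs_div, abs_sub_comm b, abs_of_pos (mul_pos ha' hb')]
  gcongr
  nlinarith

/-- The constant of the `L²` approximation property. -/
def approxConst (σ w : ℝ) : ℝ :=
  kernelErrorConst σ w / massMin σ w ^ 2 * (σ ^ 2)⁻¹ + (massMin σ w)⁻¹ * kernelErrorConst σ w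

/-- The constant of the `L²`-`L^∞` stability. -/
def stabilityConst (σ w : ℝ) : ℝ := (massMin σ w)⁻¹ * (σ ^ 2)⁻¹

/-- `‖K u - K_h u‖ ≤ C h ‖u‖`, with both operators written through their unnormalized kernels. -/
theorem eLpNorm_blur_sub_le {σ : ℝ} (hσ : 0 < σ) {w : ℝ} (hw : 0 < w) (hw' : w ≤ 1) {n : ℕ}
    {k₀ : Fin n × Fin n} (hk₀ : IsInterior w n k₀) (hn : 2 * gridSize n ≤ w)
    (c : Fin n × Fin n → ℝ) :
    eLpNorm (blur σ w (stepFunction n c) - stepFunction n fun k =>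
      (discreteMass σ w n)⁻¹ * (gridSize n ^ 2 * ∑ l, discreteKernel σ w n k l * c l)) 2 areaΩ ≤
      ENNReal.ofReal (approxConst σ w * gridSize n) * eLpNorm (stepFunction n c) 2 areaΩ := by
  have h0 := gridSize_nonneg n
  have hm := massMin_pos hσ hw
  have hI := massMin_le_blurMass σ hw.le hw'
  have hJ := massMin_le_discreteMass σ hw hk₀
  have hC : 0 ≤ kernelErrorConst σ w := add_nonneg (gaussLip_nonneg σ) (by positivity)
  set A := (blurMass σ w)⁻¹ with hA
  set B := (discreteMass σ w n)⁻¹ with hB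
  have hAB : |A - B| ≤ kernelErrorConst σ w * gridSize n / massMin σ w ^ 2 :=
    (abs_inv_sub_inv_le hm hI hJ).trans (by
      gcongr
      exact abs_blurMass_sub_discreteMass_le σ hw hk₀ hn)
  have hB0 : 0 ≤ B := inv_nonneg.2 (hm.le.trans hJ)
  have hBm : B ≤ (massMin σ w)⁻¹ := inv_anti₀ hm hJ
  let κ : ℝ × ℝ → ℝ × ℝ → ℝ≥0∞ := fun x y =>
    ENNReal.ofReal (|A - B| * (σ ^ 2)⁻¹ + |B| * kernelError σ w n (x - y))
  have hκ : Measurable (Function.uncurry κ) := by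
    have := (measurable_kernelError σ w n).comp
      (measurable_fst.sub measurable_snd : Measurable fun p : (ℝ × ℝ) × (ℝ × ℝ) => p.1 - p.2)
    exact ((this.const_mul _).const_add _).ennreal_ofReal
  have hrow : ∀ x, ∫⁻ y, κ x y ∂areaΩ ≤ ENNReal.ofReal (approxConst σ w * gridSize n) := by
    intro x
    have hme : Measurable fun y => ENNReal.ofReal (kernelError σ w n (x - y)) :=
      ((measurable_kernelError σ w n).comp (measurable_const.sub measurable_id)).ennreal_ofReal
    have h1 : ∀ y, κ x y = ENNReal.ofReal (|A - B| * (σ ^ 2)⁻¹) +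
        ENNReal.ofReal |B| * ENNReal.ofReal (kernelError σ w n (x - y)) := fun y => by
      rw [← ENNReal.ofReal_mul (abs_nonneg B), ← ENNReal.ofReal_add (by positivity)
        (mul_nonneg (abs_nonneg B) (kernelError_nonneg _ _ _ _))]
    simp_rw [h1]
    rw [lintegral_add_left measurable_const, lintegral_const, measure_univ, mul_one,
      lintegral_const_mul _ hme]
    calc _ ≤ ENNReal.ofReal (|A - B| * (σ ^ 2)⁻¹) +
          ENNReal.ofReal |B| * ENNReal.ofReal (kernelErrorConst σ w * gridSize n) := by
          gcongr
          exact lintegral_kernelError_le σ hn x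
      _ = ENNReal.ofReal (|A - B| * (σ ^ 2)⁻¹ + |B| * (kernelErrorConst σ w * gridSize n)) := by
          rw [← ENNReal.ofReal_mul (abs_nonneg B), ← ENNReal.ofReal_add (by positivity)
            (by positivity)]
      _ ≤ _ := by
          refine ENNReal.ofReal_le_ofReal ?_
          rw [abs_of_nonneg hB0]
          calc _ ≤ kernelErrorConst σ w * gridSize n / massMin σ w ^ 2 * (σ ^ 2)⁻¹ +
                (massMin σ w)⁻¹ * (kernelErrorConst σ w * gridSize n) := by gcongr
            _ = _ := by rw [approxConst]; ring
  -- The bound is an even function of `x - y`, so the column integrals inherit the row bound.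
  have hsymm : ∀ x y, κ x y = κ y x := fun x y => by
    simp only [κ]
    rw [← kernelError_neg, neg_sub]
  refine eLpNorm_two_le_of_kernel_bound areaΩ κ hκ _ hrow
    (fun y => by simpa only [hsymm _ y] using hrow y) (measurable_stepFunction n c) ?_
  filter_upwards [ae_mem_cell k₀.1.pos] with x hx
  obtain ⟨k, hk⟩ := hx
  rw [Pi.sub_apply, blur_eq, stepFunction_of_mem _ hk]
  exact enorm_blur_sub_discreteBlur_le σ w A B hk c

/-- `‖K_h u‖_{L^∞} ≤ C ‖u‖`, with `K_h` written through its unnormalized kernel. -/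
theorem eLpNorm_top_discreteBlur_le {σ : ℝ} (hσ : 0 < σ) {w : ℝ} (hw : 0 < w) {n : ℕ}
    {k₀ : Fin n × Fin n} (hk₀ : IsInterior w n k₀) (c : Fin n × Fin n → ℝ) :
    eLpNorm (stepFunction n fun k =>
      (discreteMass σ w n)⁻¹ * (gridSize n ^ 2 * ∑ l, discreteKernel σ w n k l * c l)) ∞ areaΩ ≤
      ENNReal.ofReal (stabilityConst σ w) * eLpNorm (stepFunction n c) 2 areaΩ := by
  have hm := massMin_pos hσ hw
  have hJ := massMin_le_discreteMass σ hw hk₀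
  set B := (discreteMass σ w n)⁻¹ with hB
  have hB0 : 0 ≤ B := inv_nonneg.2 (hm.le.trans hJ)
  have hBm : B ≤ (massMin σ w)⁻¹ := inv_anti₀ hm hJ
  -- `Ω` has measure 1, so no constant is lost in passing from `L¹` to `L²`.
  have h12 : eLpNorm (stepFunction n c) 1 areaΩ ≤ eLpNorm (stepFunction n c) 2 areaΩ :=
    eLpNorm_le_eLpNorm_of_exponent_le one_le_two
      (measurable_stepFunction n c).aestronglyMeasurable
  refine le_trans ?_ (mul_le_mul_right h12 _)
  rw [eLpNorm_exponent_top, eLpNorm_one_eq_lintegral_enorm]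
  refine essSup_le_of_ae_le _ ?_
  filter_upwards [ae_mem_cell k₀.1.pos] with x hx
  obtain ⟨k, hk⟩ := hx
  rw [stepFunction_of_mem _ hk, ← integral_stepFunction n fun l => discreteKernel σ w n k l * c l,
    ← integral_const_mul, ← lintegral_const_mul _ (measurable_stepFunction n c).enorm]
  refine (enorm_integral_le_lintegral_enorm _).trans (lintegral_mono_ae ?_)
  filter_upwards [ae_mem_cell k₀.1.pos] with y hy
  obtain ⟨l, hl⟩ := hy
  rw [stepFunction_of_mem _ hl, stepFunction_of_mem _ hl, ← mul_assoc, enorm_mul]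
  gcongr
  rw [Real.enorm_eq_ofReal_abs, abs_mul, abs_of_nonneg hB0,
    abs_of_nonneg (discreteKernel_nonneg _ _ _ _ _), stabilityConst]
  exact ENNReal.ofReal_le_ofReal (mul_le_mul hBm (discreteKernel_le σ w n k l)
    (discreteKernel_nonneg σ w n k l) (inv_nonneg.2 hm.le))

/-- The renormalization parameter exists uniquely, and the two estimates hold, on fine grids. -/
theorem existsUnique_isRenormalization_and_estimates {σ w : ℝ} (hσ : 0 < σ) (hw : 0 < w)
    (hw' : w < 1 / 2) {n : ℕ} (hn : 0 < n) (h1 : gridSize n ≤ w / 2)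
    (h2 : gridSize n ≤ (1 - 2 * w) / 2) :
    (∃! η : ℝ, IsRenormalization σ w n η) ∧
      ∀ η : ℝ, IsRenormalization σ w n η → ∀ u : piecewiseConstant n,
        eLpNorm (blur σ w (u : ℝ × ℝ → ℝ) - (discreteBlur σ w n η u : ℝ × ℝ → ℝ)) 2 areaΩ ≤
          ENNReal.ofReal (approxConst σ w * gridSize n) *
            eLpNorm (u : ℝ × ℝ → ℝ) 2 areaΩ ∧
        eLpNorm (discreteBlur σ w n η u : ℝ × ℝ → ℝ) ∞ areaΩ ≤
          ENNReal.ofReal (stabilityConst σ w) * eLpNorm (u : ℝ × ℝ → ℝ) 2 areaΩ := by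
  have hint := exists_isInterior hw hn h2
  obtain ⟨k₀, hk₀⟩ := hint
  have hJ : discreteMass σ w n ≠ 0 :=
    ((massMin_pos hσ hw).trans_le (massMin_le_discreteMass σ hw hk₀)).ne'
  have hα : alpha σ (discreteWidth w n) ≠ 0 :=
    (alpha_pos hσ (hw.trans_le (le_discreteWidth w hn))).ne'
  have hiff := isRenormalization_iff (σ := σ) hw ⟨k₀, hk₀⟩
  refine ⟨?_, fun η hη u => ?_⟩
  · simp only [hiff]
    have hS : (2 * alpha σ (discreteWidth w n) * Real.pi)⁻¹ * discreteMass σ w n ≠ 0 :=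
      mul_ne_zero (inv_ne_zero (mul_ne_zero (mul_ne_zero two_ne_zero hα) Real.pi_ne_zero)) hJ
    refine ⟨((2 * alpha σ (discreteWidth w n) * Real.pi)⁻¹ * discreteMass σ w n)⁻¹ - 1, ?_, ?_⟩
    · simp only [add_sub_cancel, inv_mul_cancel₀ hS]
    · intro η hη
      rw [← eq_inv_of_mul_eq_one_left hη]
      ring
  · obtain ⟨c, hc⟩ := u.2
    rw [discreteBlur_stepFunction ((hiff η).1 hη) u c hc, ← hc]
    exact ⟨eLpNorm_blur_sub_le hσ hw (by linarith) hk₀ (by linarith) c,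
      eLpNorm_top_discreteBlur_le hσ hw hk₀ c⟩

end GaussianBlur

end

theorem theoremA4 (σ w : ℝ) (hσ : 0 < σ) (hw : 0 < w) (hw' : w < 1 / 2) :
    ∃ C : ℝ, 0 < C ∧ ∃ h₀ : ℝ, 0 < h₀ ∧
      (∀ n : ℕ, 0 < n → GaussianBlur.gridSize n ≤ h₀ →
        (∃! η : ℝ, GaussianBlur.IsRenormalization σ w n η) ∧
        ∀ η : ℝ, GaussianBlur.IsRenormalization σ w n η →
          ∀ u : GaussianBlur.piecewiseConstant n,
            eLpNorm (GaussianBlur.blur σ w (u : ℝ × ℝ → ℝ) -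
                (GaussianBlur.discreteBlur σ w n η u : ℝ × ℝ → ℝ)) 2 GaussianBlur.areaΩ ≤
              ENNReal.ofReal (C * GaussianBlur.gridSize n) *
                eLpNorm (u : ℝ × ℝ → ℝ) 2 GaussianBlur.areaΩ ∧
            eLpNorm (GaussianBlur.discreteBlur σ w n η u : ℝ × ℝ → ℝ) ∞ GaussianBlur.areaΩ ≤
              ENNReal.ofReal C * eLpNorm (u : ℝ × ℝ → ℝ) 2 GaussianBlur.areaΩ) ∧
      (∀ (n : ℕ → ℕ) (η : ℕ → ℝ),
        (∀ j, 0 < n j ∧ GaussianBlur.gridSize (n j) ≤ h₀ ∧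
          GaussianBlur.IsRenormalization σ w (n j) (η j)) →
        GaussianBlur.SmoothedApproximation (GaussianBlur.blur σ w)
            (fun j => GaussianBlur.piecewiseConstant (n j))
            (fun j => GaussianBlur.discreteBlur σ w (n j) (η j))
            (fun j => GaussianBlur.gridSize (n j)) C ∧
          GaussianBlur.L2LinftyStability
            (fun j => GaussianBlur.piecewiseConstant (n j))
            (fun j => GaussianBlur.discreteBlur σ w (n j) (η j)) C) := by
  have hm := GaussianBlur.massMin_pos hσ hw
  have hs : 0 < GaussianBlur.stabilityConst σ w := by
    unfold GaussianBlur.stabilityConst; positivity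
  have ha : 0 ≤ GaussianBlur.approxConst σ w := by
    have : 0 ≤ GaussianBlur.kernelErrorConst σ w :=
      add_nonneg (GaussianBlur.gaussLip_nonneg σ) (by positivity)
    unfold GaussianBlur.approxConst; positivity
  have main : ∀ n : ℕ, 0 < n → GaussianBlur.gridSize n ≤ min (w / 2) ((1 - 2 * w) / 2) →
      (∃! η : ℝ, GaussianBlur.IsRenormalization σ w n η) ∧
        ∀ η : ℝ, GaussianBlur.IsRenormalization σ w n η →
          ∀ u : GaussianBlur.piecewiseConstant n,
            eLpNorm (GaussianBlur.blur σ w (u : ℝ × ℝ → ℝ) -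
                (GaussianBlur.discreteBlur σ w n η u : ℝ × ℝ → ℝ)) 2 GaussianBlur.areaΩ ≤
              ENNReal.ofReal ((GaussianBlur.approxConst σ w + GaussianBlur.stabilityConst σ w) *
                  GaussianBlur.gridSize n) *
                eLpNorm (u : ℝ × ℝ → ℝ) 2 GaussianBlur.areaΩ ∧
            eLpNorm (GaussianBlur.discreteBlur σ w n η u : ℝ × ℝ → ℝ) ∞ GaussianBlur.areaΩ ≤
              ENNReal.ofReal (GaussianBlur.approxConst σ w + GaussianBlur.stabilityConst σ w) *
                eLpNorm (u : ℝ × ℝ → ℝ) 2 GaussianBlur.areaΩ := by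
    intro n hn h
    have h0 := GaussianBlur.gridSize_nonneg n
    obtain ⟨h1, h2⟩ := GaussianBlur.existsUnique_isRenormalization_and_estimates hσ hw hw' hn
      (h.trans (min_le_left _ _)) (h.trans (min_le_right _ _))
    refine ⟨h1, fun η hη u => ⟨(h2 η hη u).1.trans ?_, (h2 η hη u).2.trans ?_⟩⟩
    · gcongr
      linarith
    · gcongr
      linarith
  exact ⟨GaussianBlur.approxConst σ w + GaussianBlur.stabilityConst σ w, by linarith,
    min (w / 2) ((1 - 2 * w) / 2), lt_min (by linarith) (by linarith), main,
    fun n η h => ⟨fun j u => ((main (n j) (h j).1 (h j).2.1).2 (η j) (h j).2.2 u).1,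
      fun j u => ((main (n j) (h j).1 (h j).2.1).2 (η j) (h j).2.2 u).2⟩⟩
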